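/- Let $\lambda$ be an arbitrary positive odd integer. (i) Every integer $n\ge \lambda^2/8$ can be written as $n=x^2+y^2+z^2+2w^2$ with $x,y,z,w\in\mathbb{Z}$ and $x+y+2z+2w=\lambda$. (ii) Every integer $n\ge \lambda^2/16$ can be written as $n=x^2+y^2+z^2+2w^2$ with $x,y,z,w\in\mathbb{Z}$ and $x+2y+3z+2w=\lambda$. (iii) If $7\nmid\lambda$, then for every odd integer $n\ge \lambda/\sqrt{14}$ there exist $x,y,z,w\in\mathbb{Z}$ such that $n^2=x^2+y^2+z^2+w^2$ and $x+2y+3z=\lambda$. -/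

import Mathlib

/-! In (i) and (ii) the linear condition extends to an orthogonal system: `8n` (resp. `16n`) equals
`l² + r² + 2q² + 4p²` for integer linear forms `p, q, r` in `x, y, z, w`. The remainder `m = 8n -
l²` (or `16n - l²`) is 7 mod 8, so `exists_odd_sq_add_two_sq_add_four_sq` supplies odd `p, q, r`,
and suitable signs make the linear system solvable over `ℤ`. In (iii), `14n² - l²` is 5 mod 8, a sum
of three squares; the quaternion with real part `l` and norm `14n²` is then factored through one of
norm 14. The three-squares input, for 2 mod 4 and 5 mod 8, comes from reduction of ternary forms of
determinant one, Dirichlet's theorem and reciprocity. -/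

/-! ### Reduction of binary and ternary quadratic forms -/

theorem exists_abs_two_mul_add_mul_le (B A : ℤ) (hA : 0 < A) :
    ∃ k : ℤ, -A ≤ 2 * (B + k * A) ∧ 2 * (B + k * A) ≤ A := by
  refine ⟨-((2 * B + A) / (2 * A)), ?_⟩
  have h1 := Int.emod_add_mul_ediv (2 * B + A) (2 * A)
  have h2 := Int.emod_nonneg (2 * B + A) (show 2 * A ≠ 0 by omega)
  have h3 := Int.emod_lt_of_pos (2 * B + A) (show 0 < 2 * A by omega)
  constructor <;> nlinarith

/-- Lagrange reduction of a positive definite binary quadratic form `A x² + 2 B x y + C y²`. -/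
theorem binary_form_reduction (A B C D : ℤ) (hA : 0 < A) (hD : A * C - B ^ 2 = D) (hD0 : 0 < D) :
    ∃ p q r s : ℤ, p * s - q * r = 1 ∧ 0 < A * p ^ 2 + 2 * B * p * r + C * r ^ 2 ∧
      3 * (A * p ^ 2 + 2 * B * p * r + C * r ^ 2) ^ 2 ≤ 4 * D := by
  induction hn : A.toNat using Nat.strong_induction_on generalizing A B C with
  | _ n ih =>
    obtain ⟨k, hk1, hk2⟩ := exists_abs_two_mul_add_mul_le B A hA
    obtain ⟨B', hB'⟩ : ∃ B', B' = B + k * A := ⟨_, rfl⟩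
    obtain ⟨C', hC'⟩ : ∃ C', C' = A * k ^ 2 + 2 * B * k + C := ⟨_, rfl⟩
    rw [← hB'] at hk1 hk2
    have hdet : A * C' - B' ^ 2 = D := by rw [← hD, hB', hC']; ring
    have hC0 : 0 < C' := by
      by_contra h
      nlinarith [sq_nonneg B']
    by_cases hlt : C' < A
    · obtain ⟨p, q, r, s, h1, h2, h3⟩ := ih C'.toNat (by omega) C' (-B') A hC0
        (by rw [← hdet]; ring) rfl
      have key : A * (k * p - r) ^ 2 + 2 * B * (k * p - r) * p + C * p ^ 2 =
          C' * p ^ 2 + 2 * (-B') * p * r + A * r ^ 2 := by rw [hB', hC']; ring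
      refine ⟨k * p - r, k * q - s, p, q, by linear_combination h1, ?_, ?_⟩
      · rw [key]; exact h2
      · rw [key]; exact h3
    · refine ⟨1, 0, 0, 1, by norm_num, by linarith, ?_⟩
      have : 4 * B' ^ 2 ≤ A ^ 2 := by nlinarith
      have h4 : A * A ≤ A * C' := mul_le_mul_of_nonneg_left (not_lt.mp hlt) hA.le
      nlinarith

theorem binary_form_sum_two_squares (A B C : ℤ) (hA : 0 < A) (hD : A * C - B ^ 2 = 1) (y z : ℤ) :
    ∃ u v : ℤ, A * y ^ 2 + 2 * B * y * z + C * z ^ 2 = u ^ 2 + v ^ 2 := by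
  obtain ⟨p, q, r, s, h1, h2, h3⟩ := binary_form_reduction A B C 1 hA hD one_pos
  have h4 : A * p ^ 2 + 2 * B * p * r + C * r ^ 2 = 1 := by nlinarith
  refine ⟨(s * y - q * z) + (A * p * q + B * (p * s + q * r) + C * r * s) * (p * z - r * y),
    p * z - r * y, ?_⟩
  obtain ⟨Y, hY⟩ : ∃ Y, Y = s * y - q * z := ⟨_, rfl⟩
  obtain ⟨Z, hZ⟩ : ∃ Z, Z = p * z - r * y := ⟨_, rfl⟩
  obtain ⟨B', hB'⟩ : ∃ B', B' = A * p * q + B * (p * s + q * r) + C * r * s := ⟨_, rfl⟩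
  obtain ⟨C', hC'⟩ : ∃ C', C' = A * q ^ 2 + 2 * B * q * s + C * s ^ 2 := ⟨_, rfl⟩
  have hy : y = p * Y + q * Z := by rw [hY, hZ]; linear_combination (-y) * h1
  have hz : z = r * Y + s * Z := by rw [hY, hZ]; linear_combination (-z) * h1
  have hdet : C' - B' ^ 2 = 1 := by
    have : (A * p ^ 2 + 2 * B * p * r + C * r ^ 2) * C' - B' ^ 2 = 1 := by
      rw [hB', hC']
      linear_combination (p * s - q * r) ^ 2 * hD + (p * s - q * r + 1) * h1
    rwa [h4, one_mul] at this
  rw [← hY, ← hZ, ← hB']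
  have : A * y ^ 2 + 2 * B * y * z + C * z ^ 2 =
      (A * p ^ 2 + 2 * B * p * r + C * r ^ 2) * Y ^ 2 + 2 * B' * Y * Z + C' * Z ^ 2 := by
    rw [hB', hC', hy, hz]; ring
  rw [this, h4]
  linear_combination Z ^ 2 * hdet

/-- A positive definite integral ternary quadratic form with symmetric integer matrix of
determinant one represents only sums of three squares. -/
theorem ternary_form_sum_three_squares (a b c d e f : ℤ) (ha : 0 < a) (hab : 0 < a * b - d ^ 2)
    (hdet : a * b * c + 2 * d * e * f - a * f ^ 2 - b * e ^ 2 - c * d ^ 2 = 1) (x y z : ℤ) :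
    ∃ u v w : ℤ, a * x ^ 2 + b * y ^ 2 + c * z ^ 2 + 2 * d * x * y + 2 * e * x * z + 2 * f * y * z =
      u ^ 2 + v ^ 2 + w ^ 2 := by
  induction hn : a.toNat using Nat.strong_induction_on generalizing a b c d e f x y z with
  | _ n ih =>
    obtain rfl | ha1 : a = 1 ∨ 2 ≤ a := by omega
    · obtain ⟨v, w, h⟩ := binary_form_sum_two_squares (1 * b - d ^ 2) (f - d * e) (c - e ^ 2) hab
        (by linear_combination hdet) y z
      exact ⟨x + d * y + e * z, v, w, by linear_combination h⟩
    -- Completing the square, `a` times the form is `(a x + d y + e z)²` plus this binary form, of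
    -- determinant `a`. A small value `g` of it yields a value `b' < a` of the ternary form;
    -- exchanging two variables gives the descent.
    · obtain ⟨p, q, r, s, h1, h2, h3⟩ := binary_form_reduction (a * b - d ^ 2) (a * f - d * e)
        (a * c - e ^ 2) a hab (by linear_combination a * hdet) ha
      obtain ⟨k, hk1, hk2⟩ := exists_abs_two_mul_add_mul_le (d * p + e * r) a ha
      obtain ⟨g, hg⟩ : ∃ g, g = (a * b - d ^ 2) * p ^ 2 + 2 * (a * f - d * e) * p * r +
        (a * c - e ^ 2) * r ^ 2 := ⟨_, rfl⟩
      rw [← hg] at h2 h3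
      obtain ⟨d', hd'⟩ : ∃ d', d' = d * p + e * r + k * a := ⟨_, rfl⟩
      obtain ⟨b', hb'⟩ : ∃ b', b' = b * p ^ 2 + 2 * f * p * r + c * r ^ 2 +
        2 * k * (d * p + e * r) + k ^ 2 * a := ⟨_, rfl⟩
      obtain ⟨e', he'⟩ : ∃ e', e' = d * q + e * s := ⟨_, rfl⟩
      obtain ⟨f', hf'⟩ : ∃ f', f' = b * p * q + f * (p * s + q * r) + c * r * s +
        k * (d * q + e * s) := ⟨_, rfl⟩
      obtain ⟨c', hc'⟩ : ∃ c', c' = b * q ^ 2 + 2 * f * q * s + c * s ^ 2 := ⟨_, rfl⟩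
      rw [← hd'] at hk1 hk2
      have hg' : a * b' - d' ^ 2 = g := by rw [hb', hd', hg]; ring
      have hb0 : 0 < b' := by
        by_contra h
        nlinarith [sq_nonneg d']
      have hd2 : 4 * d' ^ 2 ≤ a ^ 2 := by nlinarith
      have hba : b' < a := by
        by_contra h
        have h4 : a * a ≤ a * b' := mul_le_mul_of_nonneg_left (not_lt.mp h) ha.le
        have h5 : 3 * a ^ 2 ≤ 4 * g := by linarith
        have h6 : (3 * a ^ 2) ^ 2 ≤ (4 * g) ^ 2 := pow_le_pow_left₀ (by positivity) h5 2
        have h7 : 27 * (a * a ^ 3) ≤ 64 * a := by linarith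
        have h8 : 2 ^ 3 ≤ a ^ 3 := pow_le_pow_left₀ (by norm_num) ha1 3
        have h9 : a * 2 ^ 3 ≤ a * a ^ 3 := mul_le_mul_of_nonneg_left h8 ha.le
        linarith
      have hdet' : b' * a * c' + 2 * d' * f' * e' - b' * e' ^ 2 - a * f' ^ 2 - c' * d' ^ 2 = 1 := by
        rw [hb', hc', hd', he', hf']
        linear_combination (p * s - q * r) ^ 2 * hdet + (p * s - q * r + 1) * h1
      obtain ⟨u, v, w, h⟩ := ih b'.toNat (by omega) b' a c' d' f' e' hb0 (by linarith) hdet'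
        (s * y - q * z) (x - k * (s * y - q * z)) (p * z - r * y) rfl
      refine ⟨u, v, w, h ▸ ?_⟩
      obtain ⟨Y, hY⟩ : ∃ Y, Y = s * y - q * z := ⟨_, rfl⟩
      obtain ⟨Z, hZ⟩ : ∃ Z, Z = p * z - r * y := ⟨_, rfl⟩
      have hy : y = p * Y + q * Z := by rw [hY, hZ]; linear_combination (-y) * h1
      have hz : z = r * Y + s * Z := by rw [hY, hZ]; linear_combination (-z) * h1
      rw [← hY, ← hZ, hy, hz, hb', hc', hd', he', hf']
      ring

/-! ### Sums of three squares -/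

/-- With `a = (k² + d) / (d n - 1)`, the matrix with rows `(a, k, 1)`, `(k, d n - 1, 0)`, `(1, 0,
n)` has determinant one, and its form takes the value `n` at `(0, 0, 1)`. -/
theorem sum_three_squares_of_dvd (n d k : ℤ) (hn : 2 ≤ n) (hd : 0 < d)
    (h : d * n - 1 ∣ k ^ 2 + d) : ∃ u v w : ℤ, n = u ^ 2 + v ^ 2 + w ^ 2 := by
  obtain ⟨a, ha⟩ := h
  have hm : 0 < d * n - 1 := by nlinarith
  have ha0 : 0 < a := by
    by_contra h
    nlinarith [sq_nonneg k]
  obtain ⟨u, v, w, h⟩ := ternary_form_sum_three_squares a (d * n - 1) n k 1 0 ha0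
    (by linarith) (by linear_combination (-n) * ha) 0 0 1
  exact ⟨u, v, w, by linear_combination h⟩

theorem exists_dvd_sq_add_of_jacobiSym (p : ℕ) (hp : p.Prime) (d : ℤ)
    (h : jacobiSym (-d) p = 1) : ∃ k : ℤ, (p : ℤ) ∣ k ^ 2 + d := by
  have := Fact.mk hp
  obtain ⟨x, hx⟩ := ZMod.isSquare_of_jacobiSym_eq_one h
  obtain ⟨k, rfl⟩ := ZMod.intCast_surjective x
  refine ⟨k, (ZMod.intCast_zmod_eq_zero_iff_dvd _ p).mp ?_⟩
  push_cast at hx ⊢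
  linear_combination -hx

/-- Dirichlet gives a prime `p = d n - 1` with `d` and `p` both 1 mod 4, so `(-d/p) = (p/d) = (-1/d)
= 1`. -/
theorem sum_three_squares_of_mod_four_eq_two (n : ℕ) (hn : n % 4 = 2) :
    ∃ u v w : ℤ, (n : ℤ) = u ^ 2 + v ^ 2 + w ^ 2 := by
  have hcop : (n - 1).Coprime (4 * n) := by
    refine Nat.Coprime.mul_right ?_ ?_
    · have : (n - 1).Coprime 2 := (Nat.coprime_two_right).mpr (Nat.odd_iff.mpr (by omega))
      exact Nat.Coprime.mul_right this this
    · exact (Nat.coprime_self_sub_left (m := 1) (n := n) (by omega)).mpr (Nat.coprime_one_left n)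
  obtain ⟨p, hpn, hp, hmod⟩ := Nat.forall_exists_prime_gt_and_modEq n (by omega) hcop
  obtain ⟨j, hj⟩ := (Nat.modEq_iff_dvd' (by omega)).mp hmod.symm
  obtain ⟨d, hd⟩ : ∃ d, d = 4 * j + 1 := ⟨_, rfl⟩
  have hpd : p + 1 = d * n := by
    have : p = 4 * n * j + (n - 1) := by omega
    rw [hd, add_mul, this, one_mul, add_assoc, Nat.sub_add_cancel (by omega)]; ring
  have hp4 : p % 4 = 1 := by
    have : d * n % 4 = 2 := by rw [Nat.mul_mod, hn, show d % 4 = 1 by omega]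
    omega
  have hd4 : d % 4 = 1 := by omega
  have hodd : Odd d := Nat.odd_iff.mpr (by omega)
  have hpodd : Odd p := Nat.odd_iff.mpr (by omega)
  have hJ : jacobiSym (-(d : ℤ)) p = 1 := by
    rw [neg_eq_neg_one_mul, jacobiSym.mul_left, jacobiSym.at_neg_one hpodd,
      ZMod.χ₄_nat_one_mod_four hp4, one_mul, jacobiSym.quadratic_reciprocity_one_mod_four hd4 hpodd,
      jacobiSym.mod_left' (a₂ := -1), jacobiSym.at_neg_one hodd, ZMod.χ₄_nat_one_mod_four hd4]
    exact Int.ModEq.symm <| Int.modEq_iff_dvd.mpr ⟨n, by rw [← Nat.cast_mul, ← hpd]; push_cast; ring⟩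
  obtain ⟨k, hk⟩ := exists_dvd_sq_add_of_jacobiSym p hp d hJ
  refine sum_three_squares_of_dvd n d k (by omega) (by omega) ?_
  rwa [show (d : ℤ) * n - 1 = p by rw [← Nat.cast_mul, ← hpd]; push_cast; ring]

/-- Here `2p = d n - 1` with `d` 3 mod 8 and `p` 3 mod 4: `(-d/p) = (p/d)`, which is 1 because
`(2p/d) = (-1/d) = -1 = (2/d)`. -/
theorem sum_three_squares_of_mod_eight_eq_five (n : ℕ) (hn : n % 8 = 5) :
    ∃ u v w : ℤ, (n : ℤ) = u ^ 2 + v ^ 2 + w ^ 2 := by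
  obtain ⟨a, ha⟩ : ∃ a, 3 * n = 2 * a + 1 := ⟨(3 * n - 1) / 2, by omega⟩
  have hcop : a.Coprime (4 * n) := by
    refine Nat.Coprime.mul_right ?_ ?_
    · have : a.Coprime 2 := (Nat.coprime_two_right).mpr (Nat.odd_iff.mpr (by omega))
      exact Nat.Coprime.mul_right this this
    · have h1 : a.gcd n ∣ 2 * a + 1 := ha ▸ (Nat.gcd_dvd_right a n).mul_left 3
      exact Nat.dvd_one.mp ((Nat.dvd_add_right ((Nat.gcd_dvd_left a n).mul_left 2)).mp h1)
  obtain ⟨p, hpn, hp, hmod⟩ := Nat.forall_exists_prime_gt_and_modEq (2 * n) (by omega) hcop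
  obtain ⟨j, hj⟩ := (Nat.modEq_iff_dvd' (by omega)).mp hmod.symm
  obtain ⟨d, hd⟩ : ∃ d, d = 8 * j + 3 := ⟨_, rfl⟩
  have hpa : p = 4 * n * j + a := by omega
  have hpd : 2 * p + 1 = d * n := by
    rw [hd, hpa]; linear_combination -ha
  have hp4 : p % 4 = 3 := by
    have : d * n % 8 = 7 := by rw [Nat.mul_mod, hn, show d % 8 = 3 by omega]
    omega
  have hd4 : d % 4 = 3 := by omega
  have hodd : Odd d := Nat.odd_iff.mpr (by omega)
  have hpodd : Odd p := Nat.odd_iff.mpr (by omega)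
  have h2 : jacobiSym 2 d = -1 := by
    rw [jacobiSym.at_two hodd, ZMod.χ₈_nat_eq_if_mod_eight, if_neg (by omega), if_neg (by omega)]
  have h3 : jacobiSym (2 * p) d = -1 := by
    rw [jacobiSym.mod_left' (a₂ := -1), jacobiSym.at_neg_one hodd,
      ZMod.χ₄_nat_three_mod_four hd4]
    exact Int.ModEq.symm <| Int.modEq_iff_dvd.mpr ⟨n, by rw [← Nat.cast_mul, ← hpd]; push_cast; ring⟩
  have hJ : jacobiSym (-(d : ℤ)) p = 1 := by
    rw [jacobiSym.mul_left, h2] at h3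
    rw [neg_eq_neg_one_mul, jacobiSym.mul_left, jacobiSym.at_neg_one hpodd,
      ZMod.χ₄_nat_three_mod_four hp4, jacobiSym.quadratic_reciprocity_three_mod_four hd4 hp4]
    linarith
  obtain ⟨k, hk⟩ := exists_dvd_sq_add_of_jacobiSym p hp d hJ
  -- An odd root makes `k'² + d` even, so that the modulus becomes `2p`.
  obtain ⟨k', hk', hk2⟩ : ∃ k' : ℤ, (p : ℤ) ∣ k' ^ 2 + d ∧ k' % 2 = 1 := by
    rcases Int.emod_two_eq_zero_or_one k with h | h
    · refine ⟨k + p, ?_, by omega⟩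
      rw [show (k + p) ^ 2 + (d : ℤ) = k ^ 2 + d + p * (2 * k + p) by ring]
      exact dvd_add hk (dvd_mul_right _ _)
    · exact ⟨k, hk, h⟩
  refine sum_three_squares_of_dvd n d k' (by omega) (by omega) ?_
  rw [show (d : ℤ) * n - 1 = 2 * p by rw [← Nat.cast_mul, ← hpd]; push_cast; ring]
  refine IsCoprime.mul_dvd ?_ ?_ hk'
  · exact by exact_mod_cast Nat.isCoprime_iff_coprime.mpr (Nat.coprime_two_left.mpr hpodd)
  · have : Even (k' ^ 2 + (d : ℤ)) :=
      ((Int.odd_iff.mpr hk2).pow).add_odd (by exact_mod_cast hodd)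
    exact this.two_dvd

theorem sq_emod_eight (x : ℤ) :
    x % 2 = 1 ∧ x ^ 2 % 8 = 1 ∨ x % 2 = 0 ∧ (x ^ 2 % 8 = 0 ∨ x ^ 2 % 8 = 4) := by
  have : x % 8 = 0 ∨ x % 8 = 1 ∨ x % 8 = 2 ∨ x % 8 = 3 ∨ x % 8 = 4 ∨ x % 8 = 5 ∨
    x % 8 = 6 ∨ x % 8 = 7 := by omega
  rcases this with h | h | h | h | h | h | h | h <;> simp [pow_two, Int.mul_emod, h] <;> omega

theorem sq_emod_sixteen_of_odd {x : ℤ} (hx : x % 2 = 1) :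
    (x % 8 = 1 ∨ x % 8 = 7) ∧ x ^ 2 % 16 = 1 ∨ (x % 8 = 3 ∨ x % 8 = 5) ∧ x ^ 2 % 16 = 9 := by
  have : x % 16 = 1 ∨ x % 16 = 3 ∨ x % 16 = 5 ∨ x % 16 = 7 ∨ x % 16 = 9 ∨ x % 16 = 11 ∨
    x % 16 = 13 ∨ x % 16 = 15 := by omega
  rcases this with h | h | h | h | h | h | h | h <;> simp [pow_two, Int.mul_emod, h] <;> omega

theorem odd_of_eq_sq_add_two_sq_add_four_sq {m p q r : ℤ} (hm : m % 8 = 7)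
    (h : m = r ^ 2 + 2 * q ^ 2 + 4 * p ^ 2) : p % 2 = 1 ∧ q % 2 = 1 ∧ r % 2 = 1 := by
  have hp := sq_emod_eight p
  have hq := sq_emod_eight q
  have hr := sq_emod_eight r
  omega

theorem exists_odd_sq_add_two_sq_add_four_sq (m : ℤ) (hm0 : 0 ≤ m) (hm : m % 8 = 7) :
    ∃ p q r : ℤ, m = r ^ 2 + 2 * q ^ 2 + 4 * p ^ 2 ∧ p % 2 = 1 ∧ q % 2 = 1 ∧ r % 2 = 1 := by
  suffices ∃ p q r : ℤ, m = r ^ 2 + 2 * q ^ 2 + 4 * p ^ 2 by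
    obtain ⟨p, q, r, h⟩ := this
    exact ⟨p, q, r, h, odd_of_eq_sq_add_two_sq_add_four_sq hm h⟩
  -- Halving uses `(a² + b²)/2 = s² + (s - a)²` with `s = (a + b)/2`; as `a` is odd, exactly one of
  -- `s`, `s - a` is even.
  have key : ∀ a b c : ℤ, 2 * m = a ^ 2 + b ^ 2 + c ^ 2 → a % 2 = 1 → b % 2 = 1 → c % 2 = 0 →
      ∃ p q r : ℤ, m = r ^ 2 + 2 * q ^ 2 + 4 * p ^ 2 := by
    intro a b c h ha hb hc
    obtain ⟨s, hs⟩ : ∃ s, a + b = 2 * s := ⟨(a + b) / 2, by omega⟩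
    obtain ⟨q, rfl⟩ : ∃ q, c = 2 * q := ⟨c / 2, by omega⟩
    obtain rfl : b = 2 * s - a := by omega
    rcases Int.emod_two_eq_zero_or_one s with h2 | h2
    · obtain ⟨p, rfl⟩ : ∃ p, s = 2 * p := ⟨s / 2, by omega⟩
      exact ⟨p, q, 2 * p - a, by linarith⟩
    · obtain ⟨p, hp⟩ : ∃ p, s - a = 2 * p := ⟨(s - a) / 2, by omega⟩
      obtain rfl : a = s - 2 * p := by omega
      exact ⟨p, q, s, by linarith⟩
  obtain ⟨a, b, c, h⟩ := sum_three_squares_of_mod_four_eq_two (2 * m).toNat (by omega)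
  rw [Int.toNat_of_nonneg (by omega)] at h
  have ha := sq_emod_eight a
  have hb := sq_emod_eight b
  have hc := sq_emod_eight c
  by_cases hc2 : c % 2 = 0
  · exact key a b c h (by omega) (by omega) hc2
  · by_cases hb2 : b % 2 = 0
    · exact key a c b (by linarith) (by omega) (by omega) hb2
    · exact key b c a (by linarith) (by omega) (by omega) (by omega)

/-! ### Quaternions of norm 14 and the condition `x + 2y + 3z = l` -/

/-- Modulo `7`, every integral quaternion `l + a i + b j + c k` of norm zero is annihilated on the
right by one of the eight quaternions `1 ± 3 i ± 2 j`, `1 ± 3 i ± 2 k`. -/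
theorem exists_mul_quaternion_eq_zero_zmod_seven (l a b c : ZMod 7)
    (h : l ^ 2 + a ^ 2 + b ^ 2 + c ^ 2 = 0) :
    ∃ q ∈ [(3 : ℤ), -3], ∃ t ∈ [((2 : ℤ), (0 : ℤ)), (-2, 0), (0, 2), (0, -2)],
      l - a * q - b * t.1 - c * t.2 = 0 ∧ l * q + a + b * t.2 - c * t.1 = 0 ∧
      l * t.1 - a * t.2 + b + c * q = 0 ∧ l * t.2 + a * t.1 - b * q + c = 0 := by
  revert l a b c
  set_option maxRecDepth 100000 in
  decide

theorem exists_seven_dvd_mul_quaternion (l a b c : ℤ) (h : 7 ∣ l ^ 2 + a ^ 2 + b ^ 2 + c ^ 2) :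
    ∃ q r s : ℤ, (q = 3 ∨ q = -3) ∧
      (r = 2 ∧ s = 0 ∨ r = -2 ∧ s = 0 ∨ r = 0 ∧ s = 2 ∨ r = 0 ∧ s = -2) ∧
      7 ∣ l - a * q - b * r - c * s ∧ 7 ∣ l * q + a + b * s - c * r ∧
      7 ∣ l * r - a * s + b + c * q ∧ 7 ∣ l * s + a * r - b * q + c := by
  have cast_iff : ∀ x : ℤ, (x : ZMod 7) = 0 ↔ 7 ∣ x := fun x =>
    ZMod.intCast_zmod_eq_zero_iff_dvd x 7
  have h7 : (l : ZMod 7) ^ 2 + (a : ZMod 7) ^ 2 + (b : ZMod 7) ^ 2 + (c : ZMod 7) ^ 2 = 0 := by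
    exact_mod_cast (cast_iff _).mpr h
  obtain ⟨q, hq, ⟨r, s⟩, ht, h0, h1, h2, h3⟩ :=
    exists_mul_quaternion_eq_zero_zmod_seven _ _ _ _ h7
  simp only [List.mem_cons, List.not_mem_nil, or_false, Prod.mk.injEq] at hq ht
  exact ⟨q, r, s, hq, ht, (cast_iff _).mp (by exact_mod_cast h0),
    (cast_iff _).mp (by exact_mod_cast h1), (cast_iff _).mp (by exact_mod_cast h2),
    (cast_iff _).mp (by exact_mod_cast h3)⟩

theorem exists_fourteen_mul_quaternion (l a b c : ℤ) (h : 7 ∣ l ^ 2 + a ^ 2 + b ^ 2 + c ^ 2)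
    (hl : l % 2 = 1) (ha : a % 2 = 1) (hb : b % 2 = 0) (hc : c % 2 = 0) :
    ∃ q r s x₀ x₁ x₂ x₃ : ℤ, (q = 3 ∨ q = -3) ∧
      (r = 2 ∧ s = 0 ∨ r = -2 ∧ s = 0 ∨ r = 0 ∧ s = 2 ∨ r = 0 ∧ s = -2) ∧
      l - a * q - b * r - c * s = 14 * x₀ ∧ l * q + a + b * s - c * r = 14 * x₁ ∧
      l * r - a * s + b + c * q = 14 * x₂ ∧ l * s + a * r - b * q + c = 14 * x₃ := by
  obtain ⟨q, r, s, hq, ht, h0, h1, h2, h3⟩ := exists_seven_dvd_mul_quaternion l a b c h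
  have exists_fourteen : ∀ x : ℤ, 7 ∣ x → x % 2 = 0 → ∃ y, x = 14 * y :=
    fun x hx h2 => ⟨x / 14, by omega⟩
  have parity : (l - a * q - b * r - c * s) % 2 = 0 ∧ (l * q + a + b * s - c * r) % 2 = 0 ∧
      (l * r - a * s + b + c * q) % 2 = 0 ∧ (l * s + a * r - b * q + c) % 2 = 0 := by
    rcases hq with rfl | rfl <;> rcases ht with ⟨rfl, rfl⟩ | ⟨rfl, rfl⟩ | ⟨rfl, rfl⟩ | ⟨rfl, rfl⟩ <;>
      clear h h0 h1 h2 h3 <;> omega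
  obtain ⟨x₀, e0⟩ := exists_fourteen _ h0 parity.1
  obtain ⟨x₁, e1⟩ := exists_fourteen _ h1 parity.2.1
  obtain ⟨x₂, e2⟩ := exists_fourteen _ h2 parity.2.2.1
  obtain ⟨x₃, e3⟩ := exists_fourteen _ h3 parity.2.2.2
  exact ⟨q, r, s, x₀, x₁, x₂, x₃, hq, ht, e0, e1, e2, e3⟩

/-- Let `L = l + a i + b j + c k` and `ξ = 1 + q i + r j + s k`, of norm 14. If `L ξ = 14 X`, then
`X` has norm `N` and `L = X ξ̄`, whose real part is `x₀ + q x₁ + r x₂ + s x₃ = l`. Signs and order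
of coordinates turn the coefficients into 1, 2, 3, 0. -/
theorem exists_four_squares_of_three_squares (N l a b c : ℤ)
    (h : 14 * N = l ^ 2 + a ^ 2 + b ^ 2 + c ^ 2)
    (hl : l % 2 = 1) (ha : a % 2 = 1) (hb : b % 2 = 0) (hc : c % 2 = 0) :
    ∃ x y z w : ℤ, N = x ^ 2 + y ^ 2 + z ^ 2 + w ^ 2 ∧ x + 2 * y + 3 * z = l := by
  obtain ⟨q, r, s, x₀, x₁, x₂, x₃, hq, ht, e0, e1, e2, e3⟩ :=
    exists_fourteen_mul_quaternion l a b c ⟨2 * N, by linarith⟩ hl ha hb hc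
  have hn : 1 + q ^ 2 + r ^ 2 + s ^ 2 = 14 := by
    rcases hq with rfl | rfl <;>
      rcases ht with ⟨rfl, rfl⟩ | ⟨rfl, rfl⟩ | ⟨rfl, rfl⟩ | ⟨rfl, rfl⟩ <;> norm_num
  have hN : 14 * (14 * N) = (14 * x₀) ^ 2 + (14 * x₁) ^ 2 + (14 * x₂) ^ 2 + (14 * x₃) ^ 2 := by
    rw [← e0, ← e1, ← e2, ← e3, h]
    linear_combination (-(l ^ 2 + a ^ 2 + b ^ 2 + c ^ 2)) * hn
  have hL : 14 * (x₀ + q * x₁ + r * x₂ + s * x₃) = 14 * l := by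
    linear_combination l * hn - e0 - q * e1 - r * e2 - s * e3
  obtain ⟨z, hz, hz2⟩ : ∃ z, q * x₁ = 3 * z ∧ z ^ 2 = x₁ ^ 2 := by
    rcases hq with rfl | rfl
    exacts [⟨x₁, rfl, rfl⟩, ⟨-x₁, by ring, by ring⟩]
  obtain ⟨y, w, hy, hy2⟩ : ∃ y w, r * x₂ + s * x₃ = 2 * y ∧ y ^ 2 + w ^ 2 = x₂ ^ 2 + x₃ ^ 2 := by
    rcases ht with ⟨rfl, rfl⟩ | ⟨rfl, rfl⟩ | ⟨rfl, rfl⟩ | ⟨rfl, rfl⟩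
    exacts [⟨x₂, x₃, by ring, by ring⟩, ⟨-x₂, x₃, by ring, by ring⟩,
      ⟨x₃, x₂, by ring, by ring⟩, ⟨-x₃, x₂, by ring, by ring⟩]
  exact ⟨x₀, y, z, w, by linarith, by linarith⟩

/-- Every odd `l` and every `N ≡ 1 (mod 8)` with `l² ≤ 14 N` admit a representation of `N` by four
squares whose first three bases satisfy `x + 2 y + 3 z = l`. -/
theorem exists_four_squares_with_linear_condition (N l : ℤ) (hN : N % 8 = 1) (hl : l % 2 = 1)
    (hle : l ^ 2 ≤ 14 * N) :
    ∃ x y z w : ℤ, N = x ^ 2 + y ^ 2 + z ^ 2 + w ^ 2 ∧ x + 2 * y + 3 * z = l := by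
  have hl8 := sq_emod_eight l
  obtain ⟨a, b, c, h⟩ := sum_three_squares_of_mod_eight_eq_five (14 * N - l ^ 2).toNat (by omega)
  rw [Int.toNat_of_nonneg (by omega)] at h
  have ha := sq_emod_eight a
  have hb := sq_emod_eight b
  have hc := sq_emod_eight c
  by_cases ha2 : a % 2 = 1
  · exact exists_four_squares_of_three_squares N l a b c (by linarith) hl ha2 (by omega) (by omega)
  · by_cases hb2 : b % 2 = 1
    · exact exists_four_squares_of_three_squares N l b a c (by linarith) hl hb2 (by omega) (by omega)
    · exact exists_four_squares_of_three_squares N l c a b (by linarith) hl (by omega) (by omega)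
        (by omega)

/-! ### The forms `x² + y² + z² + 2w²` with a linear condition -/

theorem exists_one_one_two_two (n l : ℤ) (hl : l % 2 = 1) (hle : l ^ 2 ≤ 8 * n) :
    ∃ x y z w : ℤ, n = x ^ 2 + y ^ 2 + z ^ 2 + 2 * w ^ 2 ∧ x + y + 2 * z + 2 * w = l := by
  have hl8 := sq_emod_eight l
  obtain ⟨p, q, r, h, hp, hq, hr⟩ :=
    exists_odd_sq_add_two_sq_add_four_sq (8 * n - l ^ 2) (by omega) (by omega)
  obtain ⟨r', hr2, hr'⟩ : ∃ r', r' ^ 2 = r ^ 2 ∧ (l - r') % 4 = 0 := by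
    by_cases hs : (l - r) % 4 = 0
    exacts [⟨r, rfl, hs⟩, ⟨-r, by ring, by omega⟩]
  obtain ⟨z, hz⟩ : ∃ z, l = r' + 4 * z := ⟨(l - r') / 4, by omega⟩
  obtain ⟨q', hq2, hq'⟩ : ∃ q', q' ^ 2 = q ^ 2 ∧ (r' + 2 * z - q') % 4 = 0 := by
    by_cases hs : (r' + 2 * z - q) % 4 = 0
    exacts [⟨q, rfl, hs⟩, ⟨-q, by ring, by omega⟩]
  obtain ⟨w, hw⟩ : ∃ w, r' + 2 * z = q' + 4 * w := ⟨(r' + 2 * z - q') / 4, by omega⟩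
  obtain ⟨x, hx⟩ : ∃ x, q' + 2 * w + p = 2 * x := ⟨(q' + 2 * w + p) / 2, by omega⟩
  refine ⟨x, x - p, z, w, ?_, by omega⟩
  obtain rfl : q' = 2 * x - p - 2 * w := by omega
  obtain rfl : r' = 2 * x - p + 2 * w - 2 * z := by omega
  subst hz
  linarith

theorem exists_one_two_three_two (n l : ℤ) (hl : l % 2 = 1) (hle : l ^ 2 ≤ 16 * n) :
    ∃ x y z w : ℤ, n = x ^ 2 + y ^ 2 + z ^ 2 + 2 * w ^ 2 ∧ x + 2 * y + 3 * z + 2 * w = l := by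
  have hl8 := sq_emod_eight l
  obtain ⟨p, q, r, h, hp, hq, hr⟩ :=
    exists_odd_sq_add_two_sq_add_four_sq (16 * n - l ^ 2) (by omega) (by omega)
  have hp8 := sq_emod_eight p
  have hq8 := sq_emod_eight q
  have hr16 := sq_emod_sixteen_of_odd hr
  have hl16 := sq_emod_sixteen_of_odd hl
  -- Since `l² + r²` is 10 mod 16, one square is 1 and the other 9, so `r` is `±3l` mod 8.
  obtain ⟨r', hr2, hr'⟩ : ∃ r', r' ^ 2 = r ^ 2 ∧ (3 * l - r') % 8 = 0 := by
    by_cases hs : (3 * l - r) % 8 = 0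
    exacts [⟨r, rfl, hs⟩, ⟨-r, by ring, by omega⟩]
  obtain ⟨q', hq2, hq'⟩ : ∃ q', q' ^ 2 = q ^ 2 ∧ (l - q') % 4 = 0 := by
    by_cases hs : (l - q) % 4 = 0
    exacts [⟨q, rfl, hs⟩, ⟨-q, by ring, by omega⟩]
  -- The sum is already 0 mod 8, and changing the sign of the odd `p` shifts it by 8 mod 16.
  obtain ⟨p', hp2, hp'⟩ : ∃ p', p' ^ 2 = p ^ 2 ∧ (l + 4 * p' + 2 * q' + 3 * r') % 16 = 0 := by
    by_cases hs : (l + 4 * p + 2 * q' + 3 * r') % 16 = 0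
    exacts [⟨p, rfl, hs⟩, ⟨-p, by ring, by omega⟩]
  obtain ⟨x, hx⟩ : ∃ x, l + 4 * p' + 2 * q' + 3 * r' = 16 * x := ⟨(l + 4 * p' + 2 * q' + 3 * r') / 16, by omega⟩
  obtain ⟨y, hy⟩ : ∃ y, l + 2 * q' - r' = 8 * y := ⟨(l + 2 * q' - r') / 8, by omega⟩
  obtain ⟨z, hz⟩ : ∃ z, 3 * l - 4 * p' - 2 * q' + r' = 16 * z := ⟨(3 * l - 4 * p' - 2 * q' + r') / 16, by omega⟩
  obtain ⟨w, hw⟩ : ∃ w, l + 4 * p' - 2 * q' - r' = 16 * w := ⟨(l + 4 * p' - 2 * q' - r') / 16, by omega⟩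
  refine ⟨x, y, z, w, ?_, by omega⟩
  obtain rfl : p' = x - z + 2 * w := by omega
  obtain rfl : q' = x + 2 * y - z - 2 * w := by omega
  obtain rfl : r' = 3 * x - 2 * y + z - 2 * w := by omega
  obtain rfl : l = x + 2 * y + 3 * z + 2 * w := by omega
  linarith

theorem theorem1p2 (l : ℤ) (hpos : 0 < l) (hodd : Odd l) :
    (∀ n : ℤ, (n : ℝ) ≥ (l : ℝ) ^ 2 / 8 →
      ∃ x y z w : ℤ, n = x ^ 2 + y ^ 2 + z ^ 2 + 2 * w ^ 2 ∧ x + y + 2 * z + 2 * w = l) ∧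
    (∀ n : ℤ, (n : ℝ) ≥ (l : ℝ) ^ 2 / 16 →
      ∃ x y z w : ℤ, n = x ^ 2 + y ^ 2 + z ^ 2 + 2 * w ^ 2 ∧ x + 2 * y + 3 * z + 2 * w = l) ∧
    (¬ (7 ∣ l) → ∀ n : ℤ, Odd n → (n : ℝ) ≥ (l : ℝ) / Real.sqrt 14 →
      ∃ x y z w : ℤ, n ^ 2 = x ^ 2 + y ^ 2 + z ^ 2 + w ^ 2 ∧ x + 2 * y + 3 * z = l) := by
  have hl := Int.odd_iff.mp hodd
  refine ⟨fun n hn => exists_one_one_two_two n l hl ?_,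
    fun n hn => exists_one_two_three_two n l hl ?_, fun _ n hn hle =>
    exists_four_squares_with_linear_condition (n ^ 2) l ?_ hl ?_⟩
  · have : (l : ℝ) ^ 2 ≤ 8 * n := by linarith
    exact_mod_cast this
  · have : (l : ℝ) ^ 2 ≤ 16 * n := by linarith
    exact_mod_cast this
  · have := sq_emod_eight n
    have := Int.odd_iff.mp hn
    omega
  · have h1 : (l : ℝ) ≤ n * Real.sqrt 14 := (div_le_iff₀ (by positivity)).mp hle
    have h2 : (l : ℝ) ^ 2 ≤ (n * Real.sqrt 14) ^ 2 :=
      pow_le_pow_left₀ (by exact_mod_cast hpos.le) h1 2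
    rw [mul_pow, Real.sq_sqrt (by norm_num)] at h2
    have : (l : ℝ) ^ 2 ≤ 14 * n ^ 2 := by linarith
    exact_mod_cast this
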